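/- Let $n\ge 1$, let $\mathcal M_n$ be the space of complex $n\times n$ matrices, and let $$\Omega_n=\{A\in\mathcal M_n : r(A)<1\}$$ be the spectral ball, where $r(A)$ denotes the spectral radius of $A$. Define $\sigma=(\sigma_1,\dots,\sigma_n):\mathcal M_n\to\mathbb C^n$ by $$\det(tI-A)=t^n+\sum_{j=1}^n(-1)^j\sigma_j(A)\,t^{n-j},$$ and let $\mathbb G_n=\sigma(\Omega_n)\subset\mathbb C^n$ be the symmetrized polydisk. Let $\mathbb D$ be the open unit disk in $\mathbb C$. For a domain $D$ in a finite-dimensional complex vector space, the Lempert function of $D$ is defined, for $z,w\in D$, by $$l_D(z,w)=\inf\{|\alpha| : \alpha\in\mathbb D \text{ and there is a holomorphic map } \varphi:\mathbb D\to D \text{ with } \varphi(0)=z,\ \varphi(\alpha)=w\}.$$ A matrix $B\in\mathcal M_n$ is called cyclic if it admits a cyclic vector, that is, a vector $v\in\mathbb C^n$ such that the vectors $B^kv$, $k\ge 0$, span $\mathbb C^n$. Let $A,B\in\Omega_n$. (i) The function $l_{\Omega_n}:\Omega_n\times\Omega_n\to\mathbb R$ is continuous at $(A,B)$ if and only if $$l_{\Omega_n}(A,B)=l_{\mathbb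 G_n}(\sigma(A),\sigma(B)).\qquad(*)$$ (ii) If $B$ is cyclic and the function $l_{\Omega_n}(\cdot,B):\Omega_n\to\mathbb R$ is continuous at $A$, then $(*)$ holds. -/

import Mathlib

namespace LempertSpectral

/-- The spectral ball: the complex `n × n` matrices of spectral radius less than one. -/
def spectralBall (n : ℕ) : Set (Matrix (Fin n) (Fin n) ℂ) :=
  {A | spectralRadius ℂ A < 1}

/-- The map `σ = (σ₁, …, σₙ)`, where `det (t I - A) = tⁿ + ∑ⱼ (-1)ʲ σⱼ(A) tⁿ⁻ʲ`.
The coordinate of index `j : Fin n` (counted from `0`) is `σ_{j+1}(A)`. -/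
noncomputable def sigma {n : ℕ} (A : Matrix (Fin n) (Fin n) ℂ) : Fin n → ℂ :=
  fun j => (-1) ^ ((j : ℕ) + 1) * A.charpoly.coeff (n - ((j : ℕ) + 1))

/-- The symmetrized polydisk, the image of the spectral ball under `σ`. -/
def symmetrizedPolydisk (n : ℕ) : Set (Fin n → ℂ) :=
  sigma '' spectralBall n

/-- The Lempert function of a domain `D`: the infimum of `|α|` over all `α` in the open unit disk
for which some holomorphic map `φ` from the disk to `D` has `φ 0 = z` and `φ α = w`. -/
noncomputable def lempert {E : Type*} [AddCommGroup E] [Module ℂ E] [TopologicalSpace E]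
    (D : Set E) (z w : E) : ℝ :=
  sInf {r : ℝ | ∃ α ∈ Metric.ball (0 : ℂ) 1, r = ‖α‖ ∧
    ∃ φ : ℂ → E, DifferentiableOn ℂ φ (Metric.ball 0 1) ∧
      Set.MapsTo φ (Metric.ball 0 1) D ∧ φ 0 = z ∧ φ α = w}

/-- A matrix is cyclic if it admits a cyclic vector. -/
def IsCyclic {n : ℕ} (A : Matrix (Fin n) (Fin n) ℂ) : Prop :=
  ∃ v : Fin n → ℂ, Submodule.span ℂ (Set.range fun k : ℕ => (A ^ k).mulVec v) = ⊤

end LempertSpectral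

/-!
Write `Ω` for the spectral ball, `𝔾 = σ(Ω)` for the symmetrized polydisk, and `l_Ω`, `l_𝔾` for their
Lempert functions. Composing disks with the holomorphic map `σ` gives
`l_𝔾(σ(A), σ(B)) ≤ l_Ω(A, B)` (`lempert_sigma_le`). Three further facts give the theorem.

* Equality holds when `A` and `B` are cyclic (`lempert_eq_of_isCyclic`). A disk `φ` in `𝔾` lifts to
  the companion matrices of the points `φ(x)`. A cyclic matrix is similar to the companion matrix of
  its characteristic polynomial, and conjugating by a holomorphic curve in the connected group
  `GLₙ(ℂ)` moves the two endpoints of the lift to `A` and `B` (`Reaches.lift`). Cyclic matrices are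
  dense (`dense_isCyclic`).
* Both Lempert functions are upper semicontinuous (`eventually_lempert_lt`): a slightly shrunk disk
  has relatively compact image and can be perturbed. This uses that any two points lie on some disk;
  otherwise the infimum is over the empty set and takes the value `0`. Such disks exist because `Ω`
  contains a real segment of an entire curve from `A` to `B`, and any neighbourhood of `[0, 1]` in `ℂ`
  contains a holomorphic disk through `0` and `1` (`exists_reaches_spectralBall`).
* `l_𝔾` is lower semicontinuous (`eventually_lt_lempert_symmetrizedPolydisk`). As `𝔾` is bounded,
  disks in `𝔾` converge locally uniformly along an ultrafilter. A point `z` lies in `𝔾` exactly when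
  `1 + ∑ⱼ (-1)ʲ zⱼ sʲ` has no zero `s` in the closed unit disk, so Hurwitz's theorem, for each such
  `s`, shows that the limit disk stays in `𝔾`.

If `l_Ω` is continuous at `(A, B)`, approximating by cyclic pairs gives `l_Ω(A, B) ≤ l_𝔾(σ(A), σ(B))`;
when `B` is cyclic it is enough to approximate `A`. Conversely, if the two values agree at `(A, B)`,
then `l_Ω` is upper semicontinuous and bounded below by a lower semicontinuous function with the same
value there.
-/

open Filter Topology Metric Set

namespace LempertSpectral

/-! ### The Lempert function of a general domain -/

section Lempert

/-- Some holomorphic map from the unit disk to `D` takes `0` to `z` and `α` to `w`. -/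
def Reaches {E : Type*} [AddCommGroup E] [Module ℂ E] [TopologicalSpace E]
    (D : Set E) (z w : E) (α : ℂ) : Prop :=
  α ∈ ball (0 : ℂ) 1 ∧ ∃ φ : ℂ → E, DifferentiableOn ℂ φ (ball 0 1) ∧
    MapsTo φ (ball 0 1) D ∧ φ 0 = z ∧ φ α = w

section TVS

variable {E : Type*} [AddCommGroup E] [Module ℂ E] [TopologicalSpace E]
  {E' : Type*} [AddCommGroup E'] [Module ℂ E'] [TopologicalSpace E']
  {D : Set E} {D' : Set E'} {z w : E} {z' w' : E'} {α : ℂ} {c : ℝ}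

theorem lempert_eq_sInf :
    lempert D z w = sInf {r : ℝ | ∃ α, Reaches D z w α ∧ ‖α‖ = r} := by
  unfold lempert Reaches
  congr 1
  ext r
  constructor
  · rintro ⟨α, h1, rfl, h2⟩
    exact ⟨α, ⟨h1, h2⟩, rfl⟩
  · rintro ⟨α, ⟨h1, h2⟩, rfl⟩
    exact ⟨α, h1, rfl, h2⟩

theorem Reaches.lempert_le (h : Reaches D z w α) : lempert D z w ≤ ‖α‖ := by
  rw [lempert_eq_sInf]
  refine csInf_le ⟨0, ?_⟩ ⟨α, h, rfl⟩
  rintro _ ⟨β, -, rfl⟩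
  exact norm_nonneg β

theorem lempert_le_one : lempert D z w ≤ 1 := by
  by_cases h : ∃ α, Reaches D z w α
  · obtain ⟨α, h⟩ := h
    exact h.lempert_le.trans (mem_ball_zero_iff.1 h.1).le
  · push Not at h
    simp [lempert_eq_sInf, h]

/-- The infimum defining the Lempert function may be taken over `α ≠ 0`: a disk with `α = 0` forces
`z = w`, and then the constant disk serves for every `α`. -/
theorem exists_reaches_of_lempert_lt (hne : ∃ α, Reaches D z w α) (h : lempert D z w < c) :
    ∃ α, α ≠ 0 ∧ ‖α‖ < c ∧ Reaches D z w α := by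
  rw [lempert_eq_sInf] at h
  obtain ⟨_, ⟨α, hα, rfl⟩, hc⟩ := exists_lt_of_csInf_lt (by
    obtain ⟨α, h⟩ := hne
    exact ⟨_, α, h, rfl⟩) h
  by_cases h0 : α = 0
  · subst h0
    obtain ⟨-, φ, -, hm, hz, hw⟩ := hα
    have hc0 : 0 < c := by simpa using hc
    have hm0 : 0 < min c 1 / 2 := by positivity
    have hn : ‖((min c 1 / 2 : ℝ) : ℂ)‖ = min c 1 / 2 := by
      rw [Complex.norm_real, Real.norm_of_nonneg hm0.le]
    have h1 := min_le_left c 1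
    have h2 := min_le_right c 1
    refine ⟨((min c 1 / 2 : ℝ) : ℂ), ?_, ?_, ?_, fun _ => z, ?_, ?_, rfl, ?_⟩
    · exact_mod_cast hm0.ne'
    · rw [hn]; linarith
    · rw [mem_ball_zero_iff, hn]; linarith
    · exact differentiableOn_const z
    · intro x _
      rw [← hz]
      exact hm (by simp)
    · rw [← hz, hw]
  · exact ⟨α, h0, hc, hα⟩

theorem lempert_le_lempert (hne : ∃ α, Reaches D z w α)
    (H : ∀ α ≠ 0, Reaches D z w α → Reaches D' z' w' α) :
    lempert D' z' w' ≤ lempert D z w := by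
  refine le_of_forall_gt fun c hc => ?_
  obtain ⟨α, h0, hαc, hα⟩ := exists_reaches_of_lempert_lt hne hc
  exact (H α h0 hα).lempert_le.trans_lt hαc

end TVS

variable {E : Type*} [NormedAddCommGroup E] [NormedSpace ℂ E] {D : Set E} {z w : E} {α : ℂ} {c : ℝ}

/-- A disk through `z` and `w`, restricted to a slightly smaller radius, has relatively compact
image, so adding a small affine map yields a disk through any pair close to `(z, w)`. -/
theorem Reaches.eventually_lempert_lt (hD : IsOpen D) (h : Reaches D z w α) (h0 : α ≠ 0)
    (hc : ‖α‖ < c) : ∀ᶠ p in 𝓝 (z, w), lempert D p.1 p.2 < c := by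
  obtain ⟨hα, φ, hφ, hm, hz, hw⟩ := h
  rw [mem_ball_zero_iff] at hα
  have hα0 : 0 < ‖α‖ := norm_pos_iff.2 h0
  have hc0 : 0 < c := hα0.trans hc
  obtain ⟨r, hr, hr1⟩ : ∃ r, max ‖α‖ (‖α‖ / c) < r ∧ r < 1 :=
    exists_between (max_lt hα ((div_lt_one hc0).2 hc))
  have hr0 : 0 < r := (hα0.trans_le (le_max_left _ _)).trans hr
  have hβ1 : ‖α‖ / r < 1 := (div_lt_one hr0).2 ((le_max_left _ _).trans_lt hr)
  have hβc : ‖α‖ / r < c := by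
    rw [div_lt_iff₀ hr0, mul_comm, ← div_lt_iff₀ hc0]
    exact (le_max_right _ _).trans_lt hr
  have hrC : (r : ℂ) ≠ 0 := by exact_mod_cast hr0.ne'
  have hβn : ‖α / (r : ℂ)‖ = ‖α‖ / r := by
    rw [norm_div, Complex.norm_real, Real.norm_of_nonneg hr0.le]
  set β : ℂ := α / r with hβ
  have hβ0 : β ≠ 0 := div_ne_zero h0 hrC
  have hsub : closedBall (0 : ℂ) r ⊆ ball 0 1 := closedBall_subset_ball hr1
  obtain ⟨δ, hδ, hthick⟩ := ((isCompact_closedBall (0 : ℂ) r).image_of_continuousOn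
    (hφ.continuousOn.mono hsub)).exists_thickening_subset_open hD
      (image_subset_iff.2 fun x hx => hm (hsub hx))
  have hcont : Continuous fun p : E × E =>
      (1 + 1 / ‖β‖) * ‖p.1 - z‖ + 1 / ‖β‖ * ‖p.2 - w‖ := by fun_prop
  have hev := hcont.tendsto (z, w)
  simp only [sub_self, norm_zero, mul_zero, add_zero] at hev
  filter_upwards [hev.eventually_lt_const hδ] with p hp
  refine lt_of_le_of_lt (Reaches.lempert_le (α := β) ⟨?_, fun x =>
    φ (r * x) + ((1 - x / β) • (p.1 - z) + (x / β) • (p.2 - w)), ?_, ?_, ?_, ?_⟩) (hβn ▸ hβc)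
  · rw [mem_ball_zero_iff, hβn]
    exact hβ1
  · refine DifferentiableOn.add (hφ.comp (by fun_prop) ?_) (by fun_prop)
    intro x hx
    refine hsub ?_
    rw [mem_closedBall_zero_iff, norm_mul, Complex.norm_real, Real.norm_of_nonneg hr0.le]
    exact mul_le_of_le_one_right hr0.le (mem_ball_zero_iff.1 hx).le
  · intro x hx
    rw [mem_ball_zero_iff] at hx
    refine hthick (mem_thickening_iff.2 ⟨φ (r * x), mem_image_of_mem _ ?_, ?_⟩)
    · rw [mem_closedBall_zero_iff, norm_mul, Complex.norm_real, Real.norm_of_nonneg hr0.le]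
      exact mul_le_of_le_one_right hr0.le hx.le
    · rw [dist_eq_norm, add_sub_cancel_left]
      have hxβ : ‖x / β‖ ≤ 1 / ‖β‖ := by
        rw [norm_div]
        gcongr
      calc _ ≤ ‖(1 - x / β) • (p.1 - z)‖ + ‖(x / β) • (p.2 - w)‖ := norm_add_le _ _
        _ = ‖1 - x / β‖ * ‖p.1 - z‖ + ‖x / β‖ * ‖p.2 - w‖ := by rw [norm_smul, norm_smul]
        _ ≤ (1 + 1 / ‖β‖) * ‖p.1 - z‖ + 1 / ‖β‖ * ‖p.2 - w‖ := by
          gcongr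
          refine (norm_sub_le _ _).trans ?_
          rw [norm_one]
          gcongr
        _ < δ := hp
  · simp [hz]
  · have : (r : ℂ) * β = α := by rw [hβ]; field_simp
    simp [this, hw, div_self hβ0]

/-- Upper semicontinuity of the Lempert function. -/
theorem eventually_lempert_lt (hD : IsOpen D) (hne : ∃ α, Reaches D z w α)
    (h : lempert D z w < c) : ∀ᶠ p in 𝓝 (z, w), lempert D p.1 p.2 < c := by
  obtain ⟨α, h0, hαc, hα⟩ := exists_reaches_of_lempert_lt hne h
  exact hα.eventually_lempert_lt hD h0 hαc

end Lempert

/-! ### Disks along a path -/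

/-- Every neighbourhood of the segment `[0, 1]` contains a holomorphic disk through `0` and `1`. -/
theorem exists_disk_near_segment {U : Set ℂ} (hU : IsOpen U)
    (h : ∀ t ∈ Icc (0 : ℝ) 1, (t : ℂ) ∈ U) : ∃ α, Reaches U 0 1 α := by
  obtain ⟨η, hη, hthick⟩ := ((isCompact_Icc (a := (0 : ℝ)) (b := 1)).image
    Complex.continuous_ofReal).exists_thickening_subset_open hU (image_subset_iff.2 h)
  obtain ⟨ε, hε0, hε1, hεη⟩ : ∃ ε : ℝ, 0 < ε ∧ ε ≤ 1 ∧ 8 * ε < η :=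
    ⟨min 1 (η / 10), by positivity, min_le_left _ _, by
      have := min_le_right 1 (η / 10); linarith⟩
  -- The power `(1 - x) ^ ε` maps the disk into a thin sector of radius `2 ^ ε`, and tends to `0`
  -- as `x → 1`; the factor `1 + ε` makes the value `1` attained.
  have hεC : (ε : ℂ) ≠ 0 := by exact_mod_cast hε0.ne'
  have hε1C : (1 : ℂ) + ε ≠ 0 := by exact_mod_cast (by positivity : (1 : ℝ) + ε ≠ 0)
  have hslit : ∀ x ∈ ball (0 : ℂ) 1, 0 < (1 - x).re := by
    intro x hx
    rw [mem_ball_zero_iff] at hx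
    have := (Complex.re_le_norm x).trans_lt hx
    simp only [Complex.sub_re, Complex.one_re]
    linarith
  have hq0 : 0 < ε / (1 + ε) := by positivity
  have hq1 : ε / (1 + ε) < 1 := (div_lt_one (by positivity)).2 (by linarith)
  set y : ℝ := Real.exp (Real.log (ε / (1 + ε)) / ε) with hy
  have hy0 : 0 < y := Real.exp_pos _
  have hy1 : y < 1 := Real.exp_lt_one_iff.2 (div_neg_of_neg_of_pos (Real.log_neg hq0 hq1) hε0)
  refine ⟨((1 - y : ℝ) : ℂ), ?_, fun x => (1 + ε) * (1 - Complex.exp (ε * Complex.log (1 - x))),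
    ?_, ?_, ?_, ?_⟩
  · rw [mem_ball_zero_iff, Complex.norm_real, Real.norm_of_nonneg (by linarith)]
    linarith
  · refine DifferentiableOn.const_mul ?_ _
    refine DifferentiableOn.const_sub (DifferentiableOn.cexp (DifferentiableOn.const_mul ?_ _)) _
    exact DifferentiableOn.clog (by fun_prop) fun x hx => Or.inl (hslit x hx)
  · intro x hx
    have hre := hslit x hx
    have hne : (1 - x) ≠ 0 := fun h => by simp [h] at hre
    have harg : |(Complex.log (1 - x)).im| ≤ 2 := by
      rw [Complex.log_im]
      have := Complex.abs_arg_lt_pi_div_two_iff.2 (Or.inl hre)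
      linarith [Real.pi_lt_four]
    have hn : ‖Complex.exp (ε * Complex.log (1 - x))‖ ≤ 1 + ε := by
      have h2 : ‖1 - x‖ ≤ 1 + 1 := by
        refine (norm_sub_le _ _).trans ?_
        rw [norm_one]
        gcongr
        exact (mem_ball_zero_iff.1 hx).le
      have : ‖Complex.exp (ε * Complex.log (1 - x))‖ = ‖1 - x‖ ^ ε := by
        rw [Complex.norm_exp, Complex.re_ofReal_mul, Complex.log_re,
          Real.rpow_def_of_pos (norm_pos_iff.2 hne), mul_comm]
      rw [this]
      refine (Real.rpow_le_rpow (norm_nonneg _) h2 hε0.le).trans ?_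
      have := rpow_one_add_le_one_add_mul_self (s := 1) (by norm_num) hε0.le hε1
      linarith
    set v := Complex.exp (ε * Complex.log (1 - x)) with hv
    have hvρ : ‖v - (‖v‖ : ℂ)‖ ≤ 4 * ε := by
      have e1 : v = (‖v‖ : ℂ) *
          Complex.exp (Complex.I * ((ε * (Complex.log (1 - x)).im : ℝ) : ℂ)) := by
        have e2 : ε * Complex.log (1 - x) = ((ε * (Complex.log (1 - x)).re : ℝ) : ℂ)
            + Complex.I * ((ε * (Complex.log (1 - x)).im : ℝ) : ℂ) := by
          apply Complex.ext <;> simp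
        rw [hv, Complex.norm_exp, Complex.re_ofReal_mul, Complex.ofReal_exp, ← Complex.exp_add]
        rw [← e2]
      have e3 := Real.norm_exp_I_mul_ofReal_sub_one_le (x := ε * (Complex.log (1 - x)).im)
      have e4 : ‖v - (‖v‖ : ℂ)‖ = ‖v‖ * ‖Complex.exp
          (Complex.I * ((ε * (Complex.log (1 - x)).im : ℝ) : ℂ)) - 1‖ := by
        conv_lhs => rw [show v - (‖v‖ : ℂ) = (‖v‖ : ℂ) * (Complex.exp
          (Complex.I * ((ε * (Complex.log (1 - x)).im : ℝ) : ℂ)) - 1) by rw [mul_sub, ← e1, mul_one]]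
        rw [norm_mul, Complex.norm_real, norm_norm]
      rw [e4]
      rw [norm_mul, Real.norm_of_nonneg hε0.le, Real.norm_eq_abs] at e3
      calc _ ≤ (2 : ℝ) * (ε * 2) := by
            gcongr
            · linarith
            · exact e3.trans (by gcongr)
        _ = 4 * ε := by ring
    refine hthick (mem_thickening_iff.2 ⟨((1 - min ‖v‖ 1 : ℝ) : ℂ), mem_image_of_mem _ ?_, ?_⟩)
    · have := le_min (norm_nonneg v) zero_le_one
      have := min_le_right ‖v‖ 1
      constructor <;> linarith
    · rw [dist_eq_norm]
      have e5 : (1 + ε) * (1 - v) - ((1 - min ‖v‖ 1 : ℝ) : ℂ)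
          = ε * (1 - v) - (v - ‖v‖) - ((‖v‖ - min ‖v‖ 1 : ℝ) : ℂ) := by
        push_cast
        ring
      have e6 : ‖(ε : ℂ) * (1 - v)‖ ≤ 3 * ε := by
        rw [norm_mul, Complex.norm_real, Real.norm_of_nonneg hε0.le]
        have := norm_sub_le 1 v
        rw [norm_one] at this
        nlinarith
      have e7 : ‖((‖v‖ - min ‖v‖ 1 : ℝ) : ℂ)‖ ≤ ε := by
        rw [Complex.norm_real, Real.norm_of_nonneg (sub_nonneg.2 (min_le_left _ _))]
        rcases min_cases ‖v‖ 1 with h | h <;> rw [h.1] <;> linarith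
      rw [e5]
      calc _ ≤ ‖(ε : ℂ) * (1 - v)‖ + ‖v - ‖v‖‖ + ‖((‖v‖ - min ‖v‖ 1 : ℝ) : ℂ)‖ :=
            (norm_sub_le _ _).trans (by gcongr; exact norm_sub_le _ _)
        _ < η := by linarith
  · simp
  · have e1 : (1 : ℂ) - ((1 - y : ℝ) : ℂ) = (y : ℂ) := by push_cast; ring
    have e2 : (ε : ℂ) * Complex.log (y : ℂ) = ((Real.log (ε / (1 + ε)) : ℝ) : ℂ) := by
      rw [← Complex.ofReal_log hy0.le, hy, Real.log_exp]
      push_cast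
      field_simp
    simp only [e1]
    rw [e2, ← Complex.ofReal_exp, Real.exp_log hq0]
    push_cast
    field_simp
    ring

/-- The endpoints of an entire curve that stays in the open set `D` for parameters in `[0, 1]` lie
on a holomorphic disk in `D`. -/
theorem exists_reaches_of_path {E : Type*} [NormedAddCommGroup E] [NormedSpace ℂ E] {D : Set E}
    (hD : IsOpen D) {g : ℂ → E} (hg : Differentiable ℂ g)
    (h : ∀ t ∈ Icc (0 : ℝ) 1, g t ∈ D) : ∃ α, Reaches D (g 0) (g 1) α := by
  obtain ⟨α, hα, f, hf, hm, h0, h1⟩ :=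
    exists_disk_near_segment (hD.preimage hg.continuous) h
  exact ⟨α, hα, g ∘ f, hg.comp_differentiableOn hf, fun x hx => hm hx,
    congrArg g h0, congrArg g h1⟩

/-! ### Limits of holomorphic maps -/

/-- Montel's theorem along an ultrafilter: a family of holomorphic maps on the disk with a common
bound converges locally uniformly. -/
theorem exists_tendstoLocallyUniformlyOn {ι E : Type*} [NormedAddCommGroup E] [NormedSpace ℂ E]
    [ProperSpace E] (𝒰 : Ultrafilter ι) {F : ι → ℂ → E} {M : ℝ}
    (hF : ∀ᶠ i in (𝒰 : Filter ι), DifferentiableOn ℂ (F i) (ball 0 1) ∧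
      ∀ x ∈ ball (0 : ℂ) 1, ‖F i x‖ ≤ M) :
    ∃ f, TendstoLocallyUniformlyOn F f 𝒰 (ball 0 1) := by
  have hlim : ∀ x ∈ ball (0 : ℂ) 1, ∃ a, Tendsto (fun i => F i x) 𝒰 (𝓝 a) := by
    intro x hx
    obtain ⟨a, -, ha⟩ := (isCompact_closedBall (0 : E) M).ultrafilter_le_nhds
      (𝒰.map fun i => F i x) (by
        rw [le_principal_iff, Ultrafilter.mem_coe, Ultrafilter.mem_map]
        filter_upwards [hF] with i hi
        exact mem_closedBall_zero_iff.2 (hi.2 x hx))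
    exact ⟨a, ha⟩
  choose! f hf using hlim
  refine ⟨f, Metric.tendstoLocallyUniformlyOn_iff.2 fun ε hε x hx => ?_⟩
  obtain ⟨R, hR, hRsub⟩ := Metric.isOpen_iff.1 isOpen_ball x hx
  obtain ⟨i₀, hi₀⟩ := hF.exists
  have hM : 0 ≤ M := (norm_nonneg _).trans (hi₀.2 x hx)
  -- The Schwarz lemma makes the family equi-Lipschitz at `x`.
  have hlip : ∀ᶠ i in (𝒰 : Filter ι), ∀ y ∈ ball x R,
      dist (F i y) (F i x) ≤ 2 * M / R * dist y x := by
    filter_upwards [hF] with i hi y hy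
    refine Complex.dist_le_div_mul_dist_of_mapsTo_ball (hi.1.mono hRsub) (fun u hu => ?_) hy
    rw [mem_closedBall, dist_eq_norm]
    linarith [norm_sub_le (F i u) (F i x), hi.2 u (hRsub hu), hi.2 x hx]
  have hlip' : ∀ y ∈ ball x R, dist (f y) (f x) ≤ 2 * M / R * dist y x := by
    intro y hy
    refine le_of_tendsto ((hf y (hRsub hy)).dist (hf x hx)) ?_
    filter_upwards [hlip] with i hi using hi y hy
  have hsmall : ∀ᶠ y in 𝓝 x, 2 * M / R * dist y x < ε / 3 := by
    have : Tendsto (fun y => 2 * M / R * dist y x) (𝓝 x) (𝓝 (2 * M / R * dist x x)) :=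
      Continuous.tendsto (by fun_prop) x
    rw [dist_self, mul_zero] at this
    exact this.eventually_lt_const (by positivity)
  refine ⟨_, mem_nhdsWithin_of_mem_nhds (inter_mem hsmall (ball_mem_nhds x hR)), ?_⟩
  filter_upwards [hlip, Metric.tendsto_nhds.1 (hf x hx) (ε / 3) (by positivity)] with i hi hix y hy
  have h1 := hi y hy.2
  have h2 := hlip' y hy.2
  have h3 : 2 * M / R * dist y x < ε / 3 := hy.1
  have h4 := dist_triangle4 (f y) (f x) (F i x) (F i y)
  rw [dist_comm (f x), dist_comm (F i x) (F i y)] at h4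
  linarith

/-- Hurwitz's theorem. -/
theorem ne_zero_of_tendstoLocallyUniformlyOn {ι : Type*} {p : Filter ι} [p.NeBot] {U : Set ℂ}
    (hU : IsOpen U) (hUc : IsPreconnected U) {F : ι → ℂ → ℂ} {f : ℂ → ℂ}
    (hf : TendstoLocallyUniformlyOn F f p U)
    (hF : ∀ᶠ i in p, DifferentiableOn ℂ (F i) U ∧ ∀ x ∈ U, F i x ≠ 0)
    {a b : ℂ} (ha : a ∈ U) (hfa : f a ≠ 0) (hb : b ∈ U) : f b ≠ 0 := by
  intro hfb
  have hd : DifferentiableOn ℂ f U := hf.differentiableOn (hF.mono fun i hi => hi.1) hU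
  have hne : ∀ᶠ z in 𝓝[≠] b, f z ≠ 0 := by
    by_contra hcon
    rw [not_eventually] at hcon
    exact hfa ((hd.analyticOnNhd hU).eqOn_zero_of_preconnected_of_frequently_eq_zero hUc hb
      (hcon.mono fun z hz => not_not.1 hz) ha)
  rw [eventually_nhdsWithin_iff] at hne
  obtain ⟨R, hR, hball⟩ := Metric.eventually_nhds_iff_ball.1 (hne.and (hU.mem_nhds hb))
  obtain ⟨r, hr, hrR⟩ := exists_between hR
  have hsub : closedBall b r ⊆ U := fun x hx => (hball x (closedBall_subset_ball hrR hx)).2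
  have hsph : ∀ x ∈ sphere b r, 0 < ‖f x‖ := fun x hx =>
    norm_pos_iff.2 ((hball x (closedBall_subset_ball hrR (sphere_subset_closedBall hx))).1
      (ne_of_mem_sphere hx hr.ne'))
  obtain ⟨δ, hδ, hδf⟩ := (isCompact_sphere b r).exists_forall_le' (a := 0)
    ((hd.continuousOn.mono (sphere_subset_closedBall.trans hsub)).norm) hsph
  have hunif := (tendstoLocallyUniformlyOn_iff_forall_isCompact hU).1 hf _ hsub
    (isCompact_closedBall b r)
  obtain ⟨i, hi, hdist⟩ := (hF.and (Metric.tendstoUniformlyOn_iff.1 hunif (δ / 2)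
    (by positivity))).exists
  -- The maximum principle for `1 / F i` on the disk bounds `F i b` away from `0`.
  have hmax : ‖(F i b)⁻¹‖ ≤ 2 / δ := by
    refine Complex.norm_le_of_forall_mem_frontier_norm_le (U := ball b r) isBounded_ball
      (f := fun x => (F i x)⁻¹) ?_ (fun z hz => ?_) (subset_closure (mem_ball_self hr))
    · have : DifferentiableOn ℂ (fun x => (F i x)⁻¹) (closedBall b r) :=
        (hi.1.mono hsub).inv fun x hx => hi.2 x (hsub hx)
      refine (this.mono ?_).diffContOnCl
      exact closure_ball_subset_closedBall
    · rw [frontier_ball b hr.ne'] at hz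
      have h1 := hdist z (sphere_subset_closedBall hz)
      have h2 := hδf z hz
      rw [dist_eq_norm] at h1
      have h3 := norm_sub_norm_le (f z) (F i z)
      rw [norm_inv, ← one_div, div_le_div_iff₀ (by linarith) hδ]
      linarith
  have hb' := hdist b (mem_closedBall_self hr.le)
  rw [hfb, dist_zero_left] at hb'
  have hpos : 0 < ‖F i b‖ := norm_pos_iff.2 (hi.2 b hb)
  rw [norm_inv, ← one_div, div_le_div_iff₀ hpos hδ] at hmax
  linarith

variable {n : ℕ}

/-! ### The symmetrized polydisk through zeros of polynomials -/

section SymmetrizedPolydisk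

open Polynomial

/-- The monic polynomial `tⁿ + ∑ⱼ (-1)ʲ zⱼ tⁿ⁻ʲ` (with `zⱼ` stored at index `j - 1`), written by
increasing powers of `t`. -/
noncomputable def polyOf (z : Fin n → ℂ) : ℂ[X] :=
  X ^ n + ∑ i : Fin n, C ((-1) ^ (n - (i : ℕ)) * z i.rev) * X ^ (i : ℕ)

theorem degree_polyOf_sum_lt (z : Fin n → ℂ) :
    (∑ i : Fin n, C ((-1) ^ (n - (i : ℕ)) * z i.rev) * X ^ (i : ℕ)).degree < (n : WithBot ℕ) := by
  exact degree_sum_fin_lt fun i : Fin n => (-1) ^ (n - (i : ℕ)) * z i.rev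

theorem monic_polyOf (z : Fin n → ℂ) : (polyOf z).Monic :=
  monic_X_pow_add (degree_polyOf_sum_lt z)

theorem coeff_polyOf (z : Fin n → ℂ) (i : Fin n) :
    (polyOf z).coeff i = (-1) ^ (n - (i : ℕ)) * z i.rev := by
  simp only [polyOf, coeff_add, coeff_X_pow, finsetSum_coeff, coeff_C_mul]
  rw [if_neg i.2.ne, zero_add, Finset.sum_eq_single i]
  · simp
  · intro j _ hj
    rw [if_neg fun h => hj (Fin.ext h.symm), mul_zero]
  · simp

theorem natDegree_polyOf (z : Fin n → ℂ) : (polyOf z).natDegree = n := by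
  refine natDegree_eq_of_degree_eq_some ?_
  rw [polyOf, degree_add_eq_left_of_degree_lt] <;> rw [degree_X_pow]
  exact degree_polyOf_sum_lt z

theorem sigma_eq_of_charpoly_eq {A : Matrix (Fin n) (Fin n) ℂ} {z : Fin n → ℂ}
    (h : A.charpoly = polyOf z) : sigma A = z := by
  funext j
  have h1 : n - ((j : ℕ) + 1) = (j.rev : ℕ) := by simp [Fin.val_rev]
  have h2 : n - (j.rev : ℕ) = (j : ℕ) + 1 := by
    rw [Fin.val_rev]; omega
  rw [sigma, h, h1, coeff_polyOf, Fin.rev_rev, h2, ← mul_assoc, ← mul_pow]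
  simp

theorem polyOf_sigma (A : Matrix (Fin n) (Fin n) ℂ) : polyOf (sigma A) = A.charpoly := by
  have hd : A.charpoly.natDegree = n := by
    simp
  have h := A.charpoly_monic.as_sum
  rw [hd, Finset.sum_range] at h
  refine Eq.trans (congrArg₂ (· + ·) rfl (Finset.sum_congr rfl fun i _ => ?_)) h.symm
  have h1 : ((i.rev : ℕ) + 1) = n - (i : ℕ) := by
    rw [Fin.val_rev]; omega
  have h2 : n - (n - (i : ℕ)) = i := by omega
  rw [sigma, h1, h2, ← mul_assoc, ← mul_pow]
  simp

/-- The reversal `1 + ∑ⱼ (-1)ʲ zⱼ sʲ` of the polynomial `polyOf z`, as a function of `s`. -/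
def revEval (z : Fin n → ℂ) (s : ℂ) : ℂ :=
  1 + ∑ j : Fin n, (-1) ^ ((j : ℕ) + 1) * z j * s ^ ((j : ℕ) + 1)

theorem revEval_eq (z : Fin n → ℂ) {s : ℂ} (hs : s ≠ 0) :
    revEval z s = s ^ n * (polyOf z).eval s⁻¹ := by
  rw [revEval, polyOf, eval_add, mul_add, eval_pow, eval_X, ← mul_pow, mul_inv_cancel₀ hs, one_pow,
    eval_finsetSum, Finset.mul_sum]
  congr 1
  refine Fintype.sum_equiv Fin.revPerm _ _ fun j => ?_
  have h1 : n - ((Fin.rev j : Fin n) : ℕ) = (j : ℕ) + 1 := by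
    rw [Fin.val_rev]; omega
  have h2 : n = ((Fin.rev j : Fin n) : ℕ) + ((j : ℕ) + 1) := by
    rw [Fin.val_rev]; omega
  have h3 : s ^ n * s⁻¹ ^ ((Fin.rev j : Fin n) : ℕ) = s ^ ((j : ℕ) + 1) := by
    have h4 : s ^ n = s ^ ((Fin.rev j : Fin n) : ℕ) * s ^ ((j : ℕ) + 1) := by
      rw [← pow_add, ← h2]
    rw [h4, mul_right_comm, ← mul_pow, mul_inv_cancel₀ hs, one_pow, one_mul]
  simp only [Fin.revPerm_apply, eval_mul, eval_C, eval_pow, eval_X, Fin.rev_rev, h1]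
  rw [← h3]
  ring

theorem revEval_ne_zero_iff (z : Fin n → ℂ) :
    (∀ s ∈ closedBall (0 : ℂ) 1, revEval z s ≠ 0) ↔ ∀ μ, (polyOf z).IsRoot μ → ‖μ‖ < 1 := by
  constructor
  · intro h μ hμ
    by_contra! hcon
    have h0 : μ ≠ 0 := fun h0 => by simp [h0] at hcon; linarith
    refine h μ⁻¹ ?_ ?_
    · rw [mem_closedBall_zero_iff, norm_inv]
      exact inv_le_one_of_one_le₀ hcon
    · rw [revEval_eq z (inv_ne_zero h0), inv_inv, hμ.eq_zero, mul_zero]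
  · intro h s hs h0
    have hs0 : s ≠ 0 := by
      rintro rfl
      simp [revEval] at h0
    rw [revEval_eq z hs0] at h0
    have := h _ ((mul_eq_zero.1 h0).resolve_left (pow_ne_zero n hs0))
    rw [norm_inv, inv_lt_one_iff₀] at this
    rw [mem_closedBall_zero_iff] at hs
    rcases this with h1 | h1
    · exact hs0 (norm_le_zero_iff.1 h1)
    · linarith

theorem mem_spectralBall_iff_roots {A : Matrix (Fin n) (Fin n) ℂ} :
    A ∈ spectralBall n ↔ ∀ μ, A.charpoly.IsRoot μ → ‖μ‖ < 1 := by
  simp only [← Matrix.mem_spectrum_iff_isRoot_charpoly]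
  rw [spectralBall, Set.mem_ofPred_eq, spectralRadius]
  constructor
  · intro h μ hμ
    have : ((‖μ‖₊ : NNReal) : ENNReal) < 1 :=
      lt_of_le_of_lt (le_iSup₂ (f := fun μ (_ : μ ∈ spectrum ℂ A) =>
        ((‖μ‖₊ : NNReal) : ENNReal)) μ hμ) h
    exact_mod_cast this
  · intro h
    have hfin : (spectrum ℂ A).Finite := by
      refine (A.charpoly.roots.toFinset.finite_toSet).subset fun μ hμ => ?_
      simpa [A.charpoly_monic.ne_zero] using Matrix.mem_spectrum_iff_isRoot_charpoly.1 hμ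
    have : (⨆ k ∈ spectrum ℂ A, ((‖k‖₊ : NNReal) : ENNReal))
        = hfin.toFinset.sup fun k => ((‖k‖₊ : NNReal) : ENNReal) := by
      rw [Finset.sup_eq_iSup]
      simp
    rw [this, Finset.sup_lt_iff (by simp)]
    intro μ hμ
    exact_mod_cast h μ (by simpa using hμ)

theorem mem_spectralBall_iff {A : Matrix (Fin n) (Fin n) ℂ} :
    A ∈ spectralBall n ↔ ∀ s ∈ closedBall (0 : ℂ) 1, revEval (sigma A) s ≠ 0 := by
  rw [mem_spectralBall_iff_roots, revEval_ne_zero_iff, polyOf_sigma]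

end SymmetrizedPolydisk

/-! ### Companion matrices and cyclic vectors -/

section Companion

open Polynomial Matrix

/-- The companion matrix of `polyOf z`: it maps each basis vector to the next one, and the last one
according to the coefficients of the polynomial. -/
noncomputable def companion (z : Fin n → ℂ) : Matrix (Fin n) (Fin n) ℂ :=
  fun i j => if (j : ℕ) + 1 = n then -(polyOf z).coeff i else if (i : ℕ) = j + 1 then 1 else 0

/-- The `k`-th standard basis vector of `ℂⁿ`, zero when `n ≤ k`. The index is a natural number so
that the `0`-th vector makes sense also for `n = 0`. -/
def basisVec (n k : ℕ) : Fin n → ℂ := fun i => if (i : ℕ) = k then 1 else 0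

theorem mulVec_basisVec (M : Matrix (Fin n) (Fin n) ℂ) (j : Fin n) (i : Fin n) :
    (M *ᵥ basisVec n j) i = M i j := by
  rw [mulVec, dotProduct, Finset.sum_eq_single j]
  · simp [basisVec]
  · intro k _ hk
    simp [basisVec, Fin.val_inj, hk]
  · simp

theorem companion_pow_mulVec (z : Fin n → ℂ) {k : ℕ} (hk : k < n) :
    (companion z) ^ k *ᵥ basisVec n 0 = basisVec n k := by
  induction k with
  | zero => simp
  | succ k ih =>
    have hk' : k < n := by omega
    rw [pow_succ', ← mulVec_mulVec, ih hk']
    funext i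
    have := mulVec_basisVec (companion z) ⟨k, hk'⟩ i
    rw [this]
    simp [companion, basisVec, hk.ne]

/-- The Krylov matrix, whose columns are `v, A v, …, Aⁿ⁻¹ v`. -/
def krylov (A : Matrix (Fin n) (Fin n) ℂ) (v : Fin n → ℂ) : Matrix (Fin n) (Fin n) ℂ :=
  fun i j => (A ^ (j : ℕ) *ᵥ v) i

theorem krylov_mulVec (A : Matrix (Fin n) (Fin n) ℂ) (v x : Fin n → ℂ) :
    krylov A v *ᵥ x = ∑ j, x j • (A ^ (j : ℕ) *ᵥ v) := by
  funext i
  simp [mulVec, dotProduct, krylov, Finset.sum_apply, mul_comm]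

theorem aeval_mulVec (A : Matrix (Fin n) (Fin n) ℂ) (v : Fin n → ℂ) {p : ℂ[X]}
    (hp : p.degree < n) : aeval A p *ᵥ v = krylov A v *ᵥ fun j => p.coeff j := by
  rw [krylov_mulVec, aeval_def, eval₂_eq_sum, ← sum_fin _ (by simp) hp, sum_mulVec]
  refine Finset.sum_congr rfl fun j _ => ?_
  rw [← Algebra.smul_def, smul_mulVec]

theorem krylov_companion (z : Fin n → ℂ) : krylov (companion z) (basisVec n 0) = 1 := by
  ext i j
  rw [krylov, companion_pow_mulVec z j.2, Matrix.one_apply]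
  simp [basisVec, Fin.ext_iff]

theorem det_krylov_ne_zero_of_span {A : Matrix (Fin n) (Fin n) ℂ} {v : Fin n → ℂ}
    (h : Submodule.span ℂ (Set.range fun k : ℕ => (A ^ k).mulVec v) = ⊤) :
    (krylov A v).det ≠ 0 := by
  rw [← isUnit_iff_ne_zero, ← Matrix.isUnit_iff_isUnit_det, ← mulVec_surjective_iff_isUnit]
  have hle : Submodule.span ℂ (Set.range fun k : ℕ => (A ^ k).mulVec v)
      ≤ LinearMap.range (krylov A v).mulVecLin := by
    rw [Submodule.span_le]
    rintro _ ⟨k, rfl⟩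
    refine ⟨fun j => (X ^ k %ₘ A.charpoly).coeff j, ?_⟩
    have hd : (X ^ k %ₘ A.charpoly).degree < n := by
      refine (degree_modByMonic_lt _ A.charpoly_monic).trans_eq ?_
      rw [A.charpoly_degree_eq_dim, Fintype.card_fin]
    rw [mulVecLin_apply, ← aeval_mulVec A v hd]
    exact congrArg (· *ᵥ v) (A.pow_eq_aeval_mod_charpoly k).symm
  rw [h, top_le_iff, LinearMap.range_eq_top] at hle
  exact hle

theorem isCyclic_of_det_krylov_ne_zero {A : Matrix (Fin n) (Fin n) ℂ} {v : Fin n → ℂ}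
    (h : (krylov A v).det ≠ 0) : IsCyclic A := by
  refine ⟨v, ?_⟩
  rw [← isUnit_iff_ne_zero, ← Matrix.isUnit_iff_isUnit_det, ← mulVec_surjective_iff_isUnit] at h
  rw [eq_top_iff]
  intro w _
  obtain ⟨x, rfl⟩ := h w
  rw [krylov_mulVec]
  exact Submodule.sum_mem _ fun j _ => Submodule.smul_mem _ _
    (Submodule.subset_span ⟨(j : ℕ), rfl⟩)

theorem krylov_mulVec_basisVec (A : Matrix (Fin n) (Fin n) ℂ) (v : Fin n → ℂ) {k : ℕ}
    (hk : k < n) :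
    krylov A v *ᵥ basisVec n k = A ^ k *ᵥ v := by
  funext i
  exact mulVec_basisVec (krylov A v) ⟨k, hk⟩ i

theorem companion_mulVec_last (z : Fin n → ℂ) (j : Fin n) (hj : (j : ℕ) + 1 = n) :
    companion z *ᵥ basisVec n j = -fun i : Fin n => (polyOf z).coeff i := by
  funext i
  rw [mulVec_basisVec]
  simp [companion, hj]

theorem aeval_polyOf_mulVec (z : Fin n → ℂ) (A : Matrix (Fin n) (Fin n) ℂ) (v : Fin n → ℂ) :
    aeval A (polyOf z) *ᵥ v = A ^ n *ᵥ v + krylov A v *ᵥ fun i : Fin n => (polyOf z).coeff i := by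
  have hd := degree_polyOf_sum_lt z
  have hc : (fun i : Fin n => (polyOf z).coeff i) = fun i : Fin n =>
      (∑ i : Fin n, C ((-1) ^ (n - (i : ℕ)) * z i.rev) * X ^ (i : ℕ)).coeff i := by
    funext i
    rw [polyOf, coeff_add, coeff_X_pow, if_neg i.2.ne, zero_add]
  rw [hc, ← aeval_mulVec A v hd, polyOf, map_add, add_mulVec, map_pow, aeval_X]

/-- Multiplication by `A`, written in the vectors `v, A v, …, Aⁿ⁻¹ v`: by the Cayley–Hamilton
theorem it is the companion matrix of the characteristic polynomial. -/
theorem mul_krylov (A : Matrix (Fin n) (Fin n) ℂ) (v : Fin n → ℂ) :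
    A * krylov A v = krylov A v * companion (sigma A) := by
  have key : ∀ j : Fin n, (A * krylov A v) *ᵥ basisVec n j
      = (krylov A v * companion (sigma A)) *ᵥ basisVec n j := by
    intro j
    rw [← mulVec_mulVec, ← mulVec_mulVec, krylov_mulVec_basisVec A v j.2, mulVec_mulVec, ← pow_succ']
    rcases (Nat.succ_le_of_lt j.2).eq_or_lt with hj | hj
    · rw [companion_mulVec_last _ j hj, mulVec_neg]
      have h := aeval_polyOf_mulVec (sigma A) A v
      rw [polyOf_sigma, aeval_self_charpoly, zero_mulVec] at h
      rw [show (j : ℕ) + 1 = n from hj, polyOf_sigma]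
      exact eq_neg_of_add_eq_zero_left h.symm
    · have e : companion (sigma A) *ᵥ basisVec n j = basisVec n ((j : ℕ) + 1) := by
        rw [← companion_pow_mulVec _ hj, ← companion_pow_mulVec _ j.2, mulVec_mulVec, ← pow_succ']
      rw [e, krylov_mulVec_basisVec A v hj]
  ext i j
  have := congrFun (key j) i
  rwa [mulVec_basisVec, mulVec_basisVec] at this

theorem companion_pow_self_mulVec (z : Fin n → ℂ) :
    companion z ^ n *ᵥ basisVec n 0 = -fun i : Fin n => (polyOf z).coeff i := by
  cases n with
  | zero => exact Subsingleton.elim _ _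
  | succ m =>
    rw [pow_succ', ← mulVec_mulVec, companion_pow_mulVec z m.lt_succ_self]
    exact companion_mulVec_last z (Fin.last m) rfl

theorem charpoly_companion (z : Fin n → ℂ) : (companion z).charpoly = polyOf z := by
  have hdeg : (polyOf z - (companion z).charpoly).degree < n := by
    have hp : (polyOf z).degree = n := by
      rw [degree_eq_natDegree (monic_polyOf z).ne_zero, natDegree_polyOf]
    have hq : (companion z).charpoly.degree = n := by
      rw [charpoly_degree_eq_dim, Fintype.card_fin]
    rw [← hp]
    refine degree_sub_lt_left (hp.trans hq.symm) (monic_polyOf z).ne_zero ?_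
    rw [(monic_polyOf z).leadingCoeff, (companion z).charpoly_monic.leadingCoeff]
  -- Both polynomials annihilate the cyclic vector, so their difference, of degree less than `n`,
  -- gives a linear relation between its first `n` iterates.
  have h1 := aeval_mulVec (companion z) (basisVec n 0) hdeg
  rw [map_sub, aeval_self_charpoly, sub_zero, aeval_polyOf_mulVec, krylov_companion, one_mulVec,
    one_mulVec, companion_pow_self_mulVec, neg_add_cancel] at h1
  refine (sub_eq_zero.1 (Polynomial.ext fun k => ?_)).symm
  rw [coeff_zero]
  rcases lt_or_ge k n with hk | hk
  · exact (congrFun h1 ⟨k, hk⟩).symm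
  · exact coeff_eq_zero_of_degree_lt (hdeg.trans_le (by exact_mod_cast hk))

theorem sigma_companion (z : Fin n → ℂ) : sigma (companion z) = z :=
  sigma_eq_of_charpoly_eq (charpoly_companion z)

theorem mem_symmetrizedPolydisk_iff {z : Fin n → ℂ} :
    z ∈ symmetrizedPolydisk n ↔ ∀ s ∈ closedBall (0 : ℂ) 1, revEval z s ≠ 0 := by
  constructor
  · rintro ⟨A, hA, rfl⟩
    exact mem_spectralBall_iff.1 hA
  · intro h
    exact ⟨companion z, mem_spectralBall_iff.2 ((sigma_companion z).symm ▸ h), sigma_companion z⟩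

theorem sigma_mem_iff {A : Matrix (Fin n) (Fin n) ℂ} :
    sigma A ∈ symmetrizedPolydisk n ↔ A ∈ spectralBall n :=
  mem_symmetrizedPolydisk_iff.trans mem_spectralBall_iff.symm

end Companion

/-! ### Topology of the spectral ball and the symmetrized polydisk -/

section Topology

theorem continuous_revEval : Continuous fun p : (Fin n → ℂ) × ℂ => revEval p.1 p.2 := by
  unfold revEval
  fun_prop

theorem isOpen_symmetrizedPolydisk : IsOpen (symmetrizedPolydisk n) := by
  rw [isOpen_iff_eventually]
  intro z hz
  simp only [mem_symmetrizedPolydisk_iff] at hz ⊢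
  refine (isCompact_closedBall (0 : ℂ) 1).eventually_forall_of_forall_eventually
    (P := fun z s => revEval z s ≠ 0) fun s hs => ?_
  exact continuous_revEval.continuousAt.eventually_ne (hz s hs)

theorem exists_norm_le_of_mem_symmetrizedPolydisk (n : ℕ) :
    ∃ M, ∀ z ∈ symmetrizedPolydisk n, ‖z‖ ≤ M := by
  refine ⟨2 ^ n, fun z hz => (pi_norm_le_iff_of_nonneg (by positivity)).2 fun j => ?_⟩
  rw [mem_symmetrizedPolydisk_iff, revEval_ne_zero_iff] at hz
  have h := Polynomial.coeff_le_of_roots_le (p := polyOf z) (f := RingHom.id ℂ) (B := 1)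
    (j.rev : ℕ) (monic_polyOf z) (IsAlgClosed.splits _) (by
      intro μ hμ
      rw [Polynomial.map_id] at hμ
      exact (hz μ (Polynomial.isRoot_of_mem_roots hμ)).le)
  rw [Polynomial.map_id, coeff_polyOf, Fin.rev_rev, natDegree_polyOf, norm_mul, norm_pow, norm_neg,
    norm_one, one_pow, one_mul, one_mul] at h
  exact h.trans (by exact_mod_cast Nat.choose_le_two_pow n _)

theorem differentiableOn_matrix_iff {φ : ℂ → Matrix (Fin n) (Fin n) ℂ} {s : Set ℂ} :
    DifferentiableOn ℂ φ s ↔ ∀ i j, DifferentiableOn ℂ (fun x => φ x i j) s := by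
  have h1 := differentiableOn_pi (𝕜 := ℂ) (s := s) (F' := fun _ : Fin n => Fin n → ℂ)
    (Φ := fun x i => φ x i)
  have h2 : ∀ i, _ := fun i => differentiableOn_pi (𝕜 := ℂ) (s := s) (F' := fun _ : Fin n => ℂ)
    (Φ := fun x j => φ x i j)
  exact h1.trans (forall_congr' h2)

theorem charpoly_coeff_eq_eval (A : Matrix (Fin n) (Fin n) ℂ) (k : ℕ) :
    A.charpoly.coeff k = MvPolynomial.eval (fun p : Fin n × Fin n => A p.1 p.2)
      ((Matrix.charpoly.univ ℂ (Fin n)).coeff k) := by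
  have h := Matrix.charpoly.univ_map_eval₂Hom (Fin n) (RingHom.id ℂ)
    (fun p : Fin n × Fin n => A p.1 p.2)
  have h' := congrArg (fun q => Polynomial.coeff q k) h
  simp only [Polynomial.coeff_map] at h'
  exact h'.symm

theorem continuous_sigma : Continuous (sigma : Matrix (Fin n) (Fin n) ℂ → Fin n → ℂ) := by
  refine continuous_pi fun j => ?_
  simp only [sigma, charpoly_coeff_eq_eval]
  refine continuous_const.mul ((MvPolynomial.continuous_eval _).comp ?_)
  exact continuous_pi fun p => continuous_id.matrix_elem p.1 p.2

theorem isOpen_spectralBall : IsOpen (spectralBall n) := by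
  have : spectralBall n = sigma ⁻¹' symmetrizedPolydisk n := by
    ext A
    exact sigma_mem_iff.symm
  rw [this]
  exact isOpen_symmetrizedPolydisk.preimage continuous_sigma

theorem differentiableOn_mvPolynomial_eval {ι : Type*} (p : MvPolynomial ι ℂ) {f : ℂ → ι → ℂ}
    {s : Set ℂ} (hf : ∀ i, DifferentiableOn ℂ (fun x => f x i) s) :
    DifferentiableOn ℂ (fun x => MvPolynomial.eval (f x) p) s := by
  induction p using MvPolynomial.induction_on with
  | C a => simp
  | add p q hp hq => simpa only [map_add] using hp.fun_add hq
  | mul_X p i hp => simpa only [map_mul, MvPolynomial.eval_X] using hp.fun_mul (hf i)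

theorem differentiableOn_sigma {φ : ℂ → Matrix (Fin n) (Fin n) ℂ} {s : Set ℂ}
    (hφ : DifferentiableOn ℂ φ s) : DifferentiableOn ℂ (fun x => sigma (φ x)) s := by
  refine differentiableOn_pi.2 fun j => ?_
  simp only [sigma, charpoly_coeff_eq_eval]
  have h := differentiableOn_mvPolynomial_eval (s := s)
    ((Matrix.charpoly.univ ℂ (Fin n)).coeff (n - ((j : ℕ) + 1)))
    (f := fun x (p : Fin n × Fin n) => φ x p.1 p.2)
    fun p => differentiableOn_matrix_iff.1 hφ p.1 p.2
  exact h.const_mul _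

theorem Reaches.sigma {A B : Matrix (Fin n) (Fin n) ℂ} {α : ℂ}
    (h : Reaches (spectralBall n) A B α) :
    Reaches (symmetrizedPolydisk n) (sigma A) (sigma B) α := by
  obtain ⟨hα, φ, hφ, hm, rfl, rfl⟩ := h
  exact ⟨hα, fun x => LempertSpectral.sigma (φ x), differentiableOn_sigma hφ,
    fun x hx => mem_image_of_mem _ (hm hx), rfl, rfl⟩

end Topology

/-! ### Existence of disks -/

section Existence

open scoped Pointwise in
theorem smul_mem_spectralBall {A : Matrix (Fin n) (Fin n) ℂ} (hA : A ∈ spectralBall n) {c : ℂ}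
    (hc : ‖c‖ ≤ 1) : c • A ∈ spectralBall n := by
  rw [mem_spectralBall_iff_roots] at hA ⊢
  intro μ hμ
  by_cases h0 : c = 0
  · rw [h0, zero_smul, Matrix.charpoly_zero] at hμ
    simp at hμ
    simp [hμ.1]
  · rw [← Matrix.mem_spectrum_iff_isRoot_charpoly] at hμ
    have h1 : spectrum ℂ (c • A) = c • spectrum ℂ A :=
      spectrum.unit_smul_eq_smul A (Units.mk0 c h0)
    rw [h1] at hμ
    obtain ⟨ν, hν, rfl⟩ := hμ
    have := hA ν (Matrix.mem_spectrum_iff_isRoot_charpoly.1 hν)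
    simp only [smul_eq_mul, norm_mul]
    nlinarith [norm_nonneg ν, norm_nonneg c]

attribute [local instance] Matrix.normedAddCommGroup Matrix.normedSpace

/-- Any two points of the spectral ball lie on a holomorphic disk: for large `k` the curve
`(1 - t)ᵏ A + tᵏ B` stays close to the segments joining `A` and `B` to `0`. -/
theorem exists_reaches_spectralBall {A B : Matrix (Fin n) (Fin n) ℂ} (hA : A ∈ spectralBall n)
    (hB : B ∈ spectralBall n) : ∃ α, Reaches (spectralBall n) A B α := by
  have hsm : ∀ X ∈ spectralBall n, (fun t : ℝ => (t : ℂ) • X) '' Icc 0 1 ⊆ spectralBall n := by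
    rintro X hX _ ⟨t, ht, rfl⟩
    refine smul_mem_spectralBall hX ?_
    rw [Complex.norm_real, Real.norm_of_nonneg ht.1]
    exact ht.2
  have hcpt : ∀ X : Matrix (Fin n) (Fin n) ℂ, IsCompact ((fun t : ℝ => (t : ℂ) • X) '' Icc 0 1) :=
    fun X => isCompact_Icc.image (by fun_prop)
  obtain ⟨η, hη, hthick⟩ := ((hcpt A).union (hcpt B)).exists_thickening_subset_open
    isOpen_spectralBall (union_subset (hsm A hA) (hsm B hB))
  obtain ⟨k, hk0, hkA, hkB⟩ : ∃ k : ℕ, k ≠ 0 ∧ (1 / 2 : ℝ) ^ k * ‖A‖ < η ∧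
      (1 / 2 : ℝ) ^ k * ‖B‖ < η := by
    have ht := tendsto_pow_atTop_nhds_zero_of_lt_one (r := (1 / 2 : ℝ)) (by norm_num) (by norm_num)
    have h1 := ht.mul_const ‖A‖
    have h2 := ht.mul_const ‖B‖
    rw [zero_mul] at h1 h2
    exact ((eventually_ne_atTop 0).and
      ((h1.eventually_lt_const hη).and (h2.eventually_lt_const hη))).exists
  let g : ℂ → Matrix (Fin n) (Fin n) ℂ := fun t => (1 - t) ^ k • A + t ^ k • B
  have hg0 : g 0 = A := by simp [g, hk0]
  have hg1 : g 1 = B := by simp [g, hk0]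
  rw [← hg0, ← hg1]
  refine exists_reaches_of_path isOpen_spectralBall (g := g) (by fun_prop) ?_
  · intro t ht
    have hn : ∀ u : ℝ, 0 ≤ u → u ≤ 1 / 2 → ∀ X : Matrix (Fin n) (Fin n) ℂ,
        ‖((u : ℂ) ^ k) • X‖ ≤ (1 / 2 : ℝ) ^ k * ‖X‖ := by
      intro u hu hu' X
      rw [norm_smul, norm_pow, Complex.norm_real, Real.norm_of_nonneg hu]
      gcongr
    have hmem : ∀ u : ℝ, u ∈ Icc (0 : ℝ) 1 → u ^ k ∈ Icc (0 : ℝ) 1 := fun u hu =>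
      ⟨pow_nonneg hu.1 k, pow_le_one₀ hu.1 hu.2⟩
    rcases le_total t (1 / 2) with h2 | h2
    · refine hthick (mem_thickening_iff.2 ⟨(((1 - t) ^ k : ℝ) : ℂ) • A,
        Or.inl (mem_image_of_mem _ (hmem _ ⟨by linarith [ht.2], by linarith [ht.1]⟩)), ?_⟩)
      have e : (1 - (t : ℂ)) ^ k • A + (t : ℂ) ^ k • B - (((1 - t) ^ k : ℝ) : ℂ) • A
          = (t : ℂ) ^ k • B := by
        push_cast
        abel
      rw [dist_eq_norm, e]
      exact (hn t ht.1 h2 B).trans_lt hkB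
    · refine hthick (mem_thickening_iff.2 ⟨((t ^ k : ℝ) : ℂ) • B,
        Or.inr (mem_image_of_mem _ (hmem _ ht)), ?_⟩)
      have e : (1 - (t : ℂ)) ^ k • A + (t : ℂ) ^ k • B - ((t ^ k : ℝ) : ℂ) • B
          = (((1 - t : ℝ) : ℂ) ^ k) • A := by
        push_cast
        abel
      rw [dist_eq_norm, e]
      exact (hn (1 - t) (by linarith [ht.2]) (by linarith) A).trans_lt hkA

theorem exists_reaches_symmetrizedPolydisk {z w : Fin n → ℂ} (hz : z ∈ symmetrizedPolydisk n)
    (hw : w ∈ symmetrizedPolydisk n) : ∃ α, Reaches (symmetrizedPolydisk n) z w α := by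
  obtain ⟨A, hA, rfl⟩ := hz
  obtain ⟨B, hB, rfl⟩ := hw
  obtain ⟨α, h⟩ := exists_reaches_spectralBall hA hB
  exact ⟨α, h.sigma⟩

/-- Upper semicontinuity of the Lempert function of the spectral ball. -/
theorem eventually_lempert_spectralBall_lt {A B : Matrix (Fin n) (Fin n) ℂ}
    (hA : A ∈ spectralBall n) (hB : B ∈ spectralBall n) {c : ℝ}
    (h : lempert (spectralBall n) A B < c) :
    ∀ᶠ p in 𝓝 (A, B), lempert (spectralBall n) p.1 p.2 < c :=
  eventually_lempert_lt isOpen_spectralBall (exists_reaches_spectralBall hA hB) h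

end Existence

/-- Upper semicontinuity of the Lempert function of the symmetrized polydisk. -/
theorem eventually_lempert_symmetrizedPolydisk_lt {z w : Fin n → ℂ}
    (hz : z ∈ symmetrizedPolydisk n) (hw : w ∈ symmetrizedPolydisk n) {c : ℝ}
    (h : lempert (symmetrizedPolydisk n) z w < c) :
    ∀ᶠ p in 𝓝 (z, w), lempert (symmetrizedPolydisk n) p.1 p.2 < c :=
  eventually_lempert_lt isOpen_symmetrizedPolydisk (exists_reaches_symmetrizedPolydisk hz hw) h

theorem lempert_sigma_le {A B : Matrix (Fin n) (Fin n) ℂ} (hA : A ∈ spectralBall n)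
    (hB : B ∈ spectralBall n) :
    lempert (symmetrizedPolydisk n) (sigma A) (sigma B) ≤ lempert (spectralBall n) A B :=
  lempert_le_lempert (exists_reaches_spectralBall hA hB) fun _ _ h => h.sigma

/-! ### Lifting disks between cyclic matrices -/

section Lifting

open Matrix

/-- `M` is joined to the identity by an entire curve of invertible matrices, whose inverses form an
entire curve as well. -/
def JoinedToOne (M : Matrix (Fin n) (Fin n) ℂ) : Prop :=
  ∃ F G : ℂ → Matrix (Fin n) (Fin n) ℂ,
    (∀ i j, Differentiable ℂ fun t => F t i j) ∧ (∀ i j, Differentiable ℂ fun t => G t i j) ∧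
    (∀ t, F t * G t = 1) ∧ F 0 = 1 ∧ F 1 = M

theorem JoinedToOne.mul {M N : Matrix (Fin n) (Fin n) ℂ} (hM : JoinedToOne M)
    (hN : JoinedToOne N) : JoinedToOne (M * N) := by
  obtain ⟨F, G, hF, hG, h, h0, h1⟩ := hM
  obtain ⟨F', G', hF', hG', h', h0', h1'⟩ := hN
  refine ⟨fun t => F t * F' t, fun t => G' t * G t, fun i j => ?_, fun i j => ?_, fun t => ?_, ?_,
    ?_⟩
  · simp only [mul_apply]
    fun_prop
  · simp only [mul_apply]
    fun_prop
  · rw [Matrix.mul_assoc, ← Matrix.mul_assoc (F' t), h', Matrix.one_mul, h]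
  · simp only [h0, h0', Matrix.one_mul]
  · simp only [h1, h1']

theorem joinedToOne_diagonal {d : Fin n → ℂ} (hd : (diagonal d).det ≠ 0) :
    JoinedToOne (diagonal d) := by
  rw [det_diagonal, Finset.prod_ne_zero_iff] at hd
  refine ⟨fun t => diagonal fun i => Complex.exp (t * Complex.log (d i)),
    fun t => diagonal fun i => Complex.exp (-(t * Complex.log (d i))), fun i j => ?_, fun i j => ?_,
    fun t => ?_, ?_, ?_⟩
  · simp only [diagonal_apply]
    split_ifs <;> fun_prop
  · simp only [diagonal_apply]
    split_ifs <;> fun_prop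
  · simp [diagonal_mul_diagonal, ← Complex.exp_add]
  · simp
  · simp only [one_mul]
    congr 1
    funext i
    exact Complex.exp_log (hd i (Finset.mem_univ i))

theorem joinedToOne_transvection {i j : Fin n} (hij : i ≠ j) (c : ℂ) :
    JoinedToOne (transvection i j c) := by
  have h : ∀ c : ℂ, ∀ a b, Differentiable ℂ fun t : ℂ => transvection i j (t * c) a b := by
    intro c a b
    simp only [transvection, Matrix.add_apply, single_apply]
    split_ifs <;> fun_prop
  refine ⟨fun t => transvection i j (t * c), fun t => transvection i j (t * -c), h c, h (-c),
    fun t => ?_, ?_, ?_⟩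
  · rw [transvection_mul_transvection_same _ _ hij]
    simp
  · simp
  · simp

theorem joinedToOne_of_det_ne_zero {M : Matrix (Fin n) (Fin n) ℂ} (hM : M.det ≠ 0) :
    JoinedToOne M :=
  diagonal_transvection_induction_of_det_ne_zero JoinedToOne M hM
    (fun _ hD => joinedToOne_diagonal hD) (fun t => joinedToOne_transvection t.hij t.c)
    fun _ _ _ _ hA hB => hA.mul hB

/-- Every holomorphic curve in the symmetrized polydisk lifts to companion matrices. Conjugating the
lift by a holomorphic curve of invertible matrices adjusts its values at `0` and `α` to any given
cyclic matrices with the right characteristic polynomials. -/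
theorem Reaches.lift {A B : Matrix (Fin n) (Fin n) ℂ} (hA : IsCyclic A) (hB : IsCyclic B) {α : ℂ}
    (h0 : α ≠ 0) (h : Reaches (symmetrizedPolydisk n) (LempertSpectral.sigma A)
      (LempertSpectral.sigma B) α) :
    Reaches (spectralBall n) A B α := by
  obtain ⟨hα, φ, hφ, hm, hz, hw⟩ := h
  obtain ⟨v, hv⟩ := hA
  obtain ⟨u, hu⟩ := hB
  have hS := det_krylov_ne_zero_of_span hv
  have hT := det_krylov_ne_zero_of_span hu
  have eA := mul_krylov A v
  have eB := mul_krylov B u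
  set S := krylov A v
  set T := krylov B u
  have hSu : IsUnit S.det := isUnit_iff_ne_zero.2 hS
  have hTu : IsUnit T.det := isUnit_iff_ne_zero.2 hT
  have hST : (S⁻¹ * T).det ≠ 0 := by
    rw [det_mul, det_nonsing_inv]
    exact mul_ne_zero (by simpa using hS) hT
  obtain ⟨F, G, hF, hG, hFG, hF0, hF1⟩ := joinedToOne_of_det_ne_zero hST
  have hG0 : G 0 = 1 := by
    have := hFG 0
    rwa [hF0, Matrix.one_mul] at this
  have hG1 : G 1 = T⁻¹ * S := by
    have h1 : (T⁻¹ * S) * F 1 = 1 := by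
      rw [hF1, Matrix.mul_assoc, mul_nonsing_inv_cancel_left _ _ hSu, nonsing_inv_mul _ hTu]
    calc G 1 = (T⁻¹ * S) * F 1 * G 1 := by rw [h1, Matrix.one_mul]
      _ = T⁻¹ * S := by rw [Matrix.mul_assoc, hFG, Matrix.mul_one]
  have hcomp : ∀ i j, DifferentiableOn ℂ (fun x => companion (φ x) i j) (ball 0 1) := by
    intro i j
    have hφi := fun i => differentiableOn_pi.1 hφ i
    simp only [companion, coeff_polyOf]
    split_ifs
    · exact ((hφi _).const_mul _).neg
    · exact differentiableOn_const _
    · exact differentiableOn_const _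
  refine ⟨hα, fun x => S * F (x / α) * companion (φ x) * (G (x / α) * S⁻¹), ?_, ?_, ?_, ?_⟩
  · refine differentiableOn_matrix_iff.2 fun i j => ?_
    have hF' : ∀ i j, Differentiable ℂ fun x => F (x / α) i j := fun i j =>
      (hF i j).comp (differentiable_id.div_const α)
    have hG' : ∀ i j, Differentiable ℂ fun x => G (x / α) i j := fun i j =>
      (hG i j).comp (differentiable_id.div_const α)
    have hF'' := fun i j => (hF' i j).differentiableOn (s := ball (0 : ℂ) 1)
    have hG'' := fun i j => (hG' i j).differentiableOn (s := ball (0 : ℂ) 1)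
    simp only [mul_apply]
    fun_prop
  · intro x hx
    rw [← sigma_mem_iff]
    have hc : (S * F (x / α) * companion (φ x) * (G (x / α) * S⁻¹)).charpoly = polyOf (φ x) := by
      have h1 : (G (x / α) * S⁻¹) * (S * F (x / α)) = 1 := by
        rw [Matrix.mul_assoc, nonsing_inv_mul_cancel_left _ _ hSu]
        exact mul_eq_one_comm.1 (hFG _)
      rw [charpoly_mul_comm, ← Matrix.mul_assoc, h1, Matrix.one_mul, charpoly_companion]
    rw [sigma_eq_of_charpoly_eq hc]
    exact hm hx
  · simp only [zero_div, hF0, hG0, hz, Matrix.mul_one, Matrix.one_mul]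
    rw [← eA, mul_nonsing_inv_cancel_right _ _ hSu]
  · simp only [div_self h0, hF1, hG1, hw]
    rw [mul_nonsing_inv_cancel_left _ _ hSu, ← eB, mul_nonsing_inv_cancel_right _ _ hSu,
      mul_nonsing_inv_cancel_right _ _ hTu]

theorem lempert_eq_of_isCyclic {A B : Matrix (Fin n) (Fin n) ℂ} (hA : A ∈ spectralBall n)
    (hB : B ∈ spectralBall n) (hAc : IsCyclic A) (hBc : IsCyclic B) :
    lempert (spectralBall n) A B =
      lempert (symmetrizedPolydisk n) (LempertSpectral.sigma A) (LempertSpectral.sigma B) :=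
  le_antisymm (lempert_le_lempert
    (exists_reaches_symmetrizedPolydisk (mem_image_of_mem _ hA) (mem_image_of_mem _ hB))
      fun _ h0 h => h.lift hAc hBc h0) (lempert_sigma_le hA hB)

theorem differentiable_det_krylov {F : ℂ → Matrix (Fin n) (Fin n) ℂ}
    (hF : ∀ i j, Differentiable ℂ fun t => F t i j) (v : Fin n → ℂ) :
    Differentiable ℂ fun t => (krylov (F t) v).det := by
  have hpow : ∀ k : ℕ, ∀ i j, Differentiable ℂ fun t => (F t ^ k) i j := by
    intro k
    induction k with
    | zero => intro i j; simp
    | succ k ih =>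
      intro i j
      simp only [pow_succ, mul_apply]
      exact Differentiable.fun_sum fun l _ => (ih i l).fun_mul (hF l j)
  have hK : ∀ i j, Differentiable ℂ fun t => krylov (F t) v i j := by
    intro i j
    simp only [krylov, mulVec, dotProduct]
    exact Differentiable.fun_sum fun l _ => (hpow j i l).mul_const _
  simp only [det_apply]
  fun_prop

/-- Cyclic matrices are dense: along the line through `A` and a companion matrix the determinant of
the Krylov matrix is a holomorphic function that does not vanish identically. -/
theorem dense_isCyclic : Dense {A : Matrix (Fin n) (Fin n) ℂ | IsCyclic A} := by
  intro A
  let N : Matrix (Fin n) (Fin n) ℂ := companion 0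
  let L : ℂ → Matrix (Fin n) (Fin n) ℂ := fun t => A + t • (N - A)
  have hL : ∀ i j, Differentiable ℂ fun t => L t i j := by
    intro i j
    simp only [L, Matrix.add_apply, Matrix.smul_apply]
    fun_prop
  have hd := differentiable_det_krylov hL (basisVec n 0)
  have hev : ∀ᶠ t in 𝓝[≠] (0 : ℂ), (krylov (L t) (basisVec n 0)).det ≠ 0 := by
    by_contra hcon
    rw [not_eventually] at hcon
    have h := (hd.differentiableOn.analyticOnNhd isOpen_univ)
      |>.eqOn_zero_of_preconnected_of_frequently_eq_zero isPreconnected_univ (mem_univ (0 : ℂ))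
        (hcon.mono fun t ht => not_not.1 ht) (mem_univ 1)
    have hL1 : L 1 = companion 0 := by simp [L, N]
    simp [hL1, krylov_companion] at h
  have ht : Tendsto L (𝓝[≠] 0) (𝓝 A) := by
    have hc : Continuous L := by fun_prop
    have := hc.tendsto 0
    simp only [L, zero_smul, add_zero] at this
    exact this.mono_left nhdsWithin_le_nhds
  exact mem_closure_of_tendsto ht (hev.mono fun t h => isCyclic_of_det_krylov_ne_zero h)

end Lifting

/-! ### Lower semicontinuity on the symmetrized polydisk -/

section LowerSemicontinuity

theorem uniformContinuous_revEval (s : ℂ) :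
    UniformContinuous fun z : Fin n → ℂ => revEval z s := by
  let L : (Fin n → ℂ) →L[ℂ] ℂ := ∑ j : Fin n,
    ((-1) ^ ((j : ℕ) + 1) * s ^ ((j : ℕ) + 1)) • ContinuousLinearMap.proj j
  have h : (fun z : Fin n → ℂ => revEval z s) = fun z => 1 + L z := by
    funext z
    simp only [revEval, L, sum_apply, smul_apply,
      ContinuousLinearMap.proj_apply, smul_eq_mul]
    congr 1
    exact Finset.sum_congr rfl fun j _ => by ring
  rw [h]
  exact uniformContinuous_const.add L.uniformContinuous

/-- The Lempert function of the symmetrized polydisk is lower semicontinuous, because limits of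
disks that do not escape to the boundary at `0` stay in the domain: for fixed `s` in the closed unit
disk the functions `x ↦ revEval (φ x) s` have no zero, and Hurwitz's theorem applies to them. -/
theorem eventually_lt_lempert_symmetrizedPolydisk {z w : Fin n → ℂ}
    (hz : z ∈ symmetrizedPolydisk n) {c : ℝ} (h : c < lempert (symmetrizedPolydisk n) z w) :
    ∀ᶠ p in 𝓝[symmetrizedPolydisk n ×ˢ symmetrizedPolydisk n] (z, w),
      c < lempert (symmetrizedPolydisk n) p.1 p.2 := by
  obtain ⟨c', hc, hc'⟩ := exists_between h
  by_contra hcon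
  have hfreq := not_eventually.1 hcon
  -- An ultrafilter converging to `(z, w)` along pairs whose Lempert function is at most `c`.
  let P : (Fin n → ℂ) × (Fin n → ℂ) → Prop := fun p =>
    p ∈ symmetrizedPolydisk n ×ˢ symmetrizedPolydisk n ∧
      ¬ c < lempert (symmetrizedPolydisk n) p.1 p.2
  have hfreq' : ∃ᶠ p in 𝓝 (z, w), P p := by
    rw [frequently_nhdsWithin_iff] at hfreq
    exact hfreq.mono fun p hp => ⟨hp.2, hp.1⟩
  have hne : (𝓝 (z, w) ⊓ 𝓟 {p | P p}).NeBot := frequently_mem_iff_neBot.1 hfreq'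
  let 𝒰 := Ultrafilter.of (𝓝 (z, w) ⊓ 𝓟 {p | P p})
  have h𝒰 : (𝒰 : Filter _) ≤ 𝓝 (z, w) ⊓ 𝓟 {p | P p} := Ultrafilter.of_le _
  have h𝒰n : Tendsto id (𝒰 : Filter ((Fin n → ℂ) × (Fin n → ℂ))) (𝓝 (z, w)) :=
    h𝒰.trans inf_le_left
  have h𝒰P : ∀ᶠ p in (𝒰 : Filter ((Fin n → ℂ) × (Fin n → ℂ))), P p :=
    le_principal_iff.1 (h𝒰.trans inf_le_right)
  have hex : ∀ p, P p → ∃ α, ‖α‖ < c' ∧ Reaches (symmetrizedPolydisk n) p.1 p.2 α := by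
    intro p hp
    obtain ⟨α, -, h1, h2⟩ := exists_reaches_of_lempert_lt
      (exists_reaches_symmetrizedPolydisk hp.1.1 hp.1.2) ((not_lt.1 hp.2).trans_lt hc)
    exact ⟨α, h1, h2⟩
  choose! α hα hR using hex
  have hφ : ∀ p, P p → ∃ φ : ℂ → Fin n → ℂ, DifferentiableOn ℂ φ (ball 0 1) ∧
    MapsTo φ (ball 0 1) (symmetrizedPolydisk n) ∧ φ 0 = p.1 ∧ φ (α p) = p.2 := fun p hp =>
      (hR p hp).2
  choose! φ hd hm hφ0 hφα using hφ
  obtain ⟨M, hM⟩ := exists_norm_le_of_mem_symmetrizedPolydisk n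
  obtain ⟨f, hf⟩ := exists_tendstoLocallyUniformlyOn 𝒰 (F := φ) (M := M)
    (h𝒰P.mono fun p hp => ⟨hd p hp, fun x hx => hM _ (hm p hp hx)⟩)
  have hfd : DifferentiableOn ℂ f (ball 0 1) := hf.differentiableOn (h𝒰P.mono hd) isOpen_ball
  obtain ⟨a, ha, hαa⟩ := (isCompact_closedBall (0 : ℂ) c').ultrafilter_le_nhds (𝒰.map α) (by
    rw [le_principal_iff, Ultrafilter.mem_coe, Ultrafilter.mem_map]
    filter_upwards [h𝒰P] with p hp
    exact mem_closedBall_zero_iff.2 (hα p hp).le)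
  rw [mem_closedBall_zero_iff] at ha
  have ha1 : a ∈ ball (0 : ℂ) 1 :=
    mem_ball_zero_iff.2 (ha.trans_lt (hc'.trans_le lempert_le_one))
  have h00 : (0 : ℂ) ∈ ball (0 : ℂ) 1 := mem_ball_self one_pos
  have hf0 : f 0 = z := by
    refine tendsto_nhds_unique (hf.tendsto_at h00) ?_
    refine ((continuous_fst.tendsto (z, w)).comp h𝒰n).congr' ?_
    exact h𝒰P.mono fun p hp => (hφ0 p hp).symm
  have hfa : f a = w := by
    have hα' : Tendsto α 𝒰 (𝓝[ball 0 1] a) :=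
      tendsto_nhdsWithin_iff.2 ⟨hαa, h𝒰P.mono fun p hp => (hR p hp).1⟩
    refine tendsto_nhds_unique
      (hf.tendsto_comp (hfd.continuousOn.continuousWithinAt ha1) ha1 hα') ?_
    refine ((continuous_snd.tendsto (z, w)).comp h𝒰n).congr' ?_
    exact h𝒰P.mono fun p hp => (hφα p hp).symm
  have hfm : MapsTo f (ball 0 1) (symmetrizedPolydisk n) := by
    intro x hx
    rw [mem_symmetrizedPolydisk_iff]
    intro s hs
    refine ne_zero_of_tendstoLocallyUniformlyOn isOpen_ball (convex_ball (0 : ℂ) 1).isPreconnected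
      ((uniformContinuous_revEval s).comp_tendstoLocallyUniformlyOn hf) (h𝒰P.mono fun p hp =>
        ⟨?_, fun y hy => mem_symmetrizedPolydisk_iff.1 (hm p hp hy) s hs⟩) h00 ?_ hx
    · have := fun i => differentiableOn_pi.1 (hd p hp) i
      simp only [Function.comp_def, revEval]
      fun_prop
    · rw [Function.comp_apply, hf0]
      exact mem_symmetrizedPolydisk_iff.1 hz s hs
  have hle := Reaches.lempert_le ⟨ha1, f, hfd, hfm, hf0, hfa⟩
  exact absurd (hle.trans ha) (not_le.2 hc')

end LowerSemicontinuity

/-! ### Continuity of the Lempert function of the spectral ball -/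

variable {A B : Matrix (Fin n) (Fin n) ℂ}

theorem tendsto_sigma_prod (A B : Matrix (Fin n) (Fin n) ℂ) :
    Tendsto (fun p : Matrix (Fin n) (Fin n) ℂ × Matrix (Fin n) (Fin n) ℂ =>
      (sigma p.1, sigma p.2)) (𝓝 (A, B)) (𝓝 (sigma A, sigma B)) :=
  ((continuous_sigma.comp continuous_fst).prodMk
    (continuous_sigma.comp continuous_snd)).tendsto (A, B)

theorem eventually_lempert_sigma_lt (hA : A ∈ spectralBall n) (hB : B ∈ spectralBall n) {c : ℝ}
    (h : lempert (symmetrizedPolydisk n) (sigma A) (sigma B) < c) :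
    ∀ᶠ p : Matrix (Fin n) (Fin n) ℂ × Matrix (Fin n) (Fin n) ℂ in 𝓝 (A, B),
      lempert (symmetrizedPolydisk n) (sigma p.1) (sigma p.2) < c :=
  (tendsto_sigma_prod A B).eventually (eventually_lempert_symmetrizedPolydisk_lt
    (mem_image_of_mem _ hA) (mem_image_of_mem _ hB) h)

/-- Cyclic pairs near `(A, B)` have equal Lempert functions upstairs and downstairs, and the one
downstairs is upper semicontinuous. -/
theorem lempert_eq_of_continuousWithinAt (hA : A ∈ spectralBall n) (hB : B ∈ spectralBall n)
    (hcont : ContinuousWithinAt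
      (fun p : Matrix (Fin n) (Fin n) ℂ × Matrix (Fin n) (Fin n) ℂ =>
        lempert (spectralBall n) p.1 p.2) (spectralBall n ×ˢ spectralBall n) (A, B)) :
    lempert (spectralBall n) A B =
      lempert (symmetrizedPolydisk n) (sigma A) (sigma B) := by
  refine le_antisymm (le_of_not_gt fun hlt => ?_) (lempert_sigma_le hA hB)
  obtain ⟨c, hc, hc'⟩ := exists_between hlt
  have hmem : spectralBall n ×ˢ spectralBall n ∈ 𝓝 (A, B) :=
    (isOpen_spectralBall.prod isOpen_spectralBall).mem_nhds ⟨hA, hB⟩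
  have hev := (hcont.continuousAt hmem).eventually_const_lt hc'
  obtain ⟨p, ⟨hp1, hp2⟩, ⟨h1, h2⟩, h3⟩ := (dense_isCyclic.prod dense_isCyclic).inter_nhds_nonempty
    (Filter.inter_mem (Filter.inter_mem hev (eventually_lempert_sigma_lt hA hB hc)) hmem)
  have heq := lempert_eq_of_isCyclic h3.1 h3.2 hp1 hp2
  exact lt_asymm (lt_of_lt_of_eq h1 heq) h2

/-- If `B` is cyclic, it suffices to perturb the first argument. -/
theorem lempert_eq_of_continuousWithinAt_left (hA : A ∈ spectralBall n) (hB : B ∈ spectralBall n)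
    (hBc : IsCyclic B)
    (hcont : ContinuousWithinAt (fun X : Matrix (Fin n) (Fin n) ℂ =>
      lempert (spectralBall n) X B) (spectralBall n) A) :
    lempert (spectralBall n) A B =
      lempert (symmetrizedPolydisk n) (sigma A) (sigma B) := by
  refine le_antisymm (le_of_not_gt fun hlt => ?_) (lempert_sigma_le hA hB)
  obtain ⟨c, hc, hc'⟩ := exists_between hlt
  have hmem := isOpen_spectralBall.mem_nhds hA
  have hev := (hcont.continuousAt hmem).eventually_const_lt hc'
  have hev' : ∀ᶠ X in 𝓝 A, lempert (symmetrizedPolydisk n) (sigma X) (sigma B) < c :=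
    ((Continuous.prodMk_left B).tendsto A).eventually (eventually_lempert_sigma_lt hA hB hc)
  obtain ⟨X, hX, ⟨h1, h2⟩, h3⟩ := dense_isCyclic.inter_nhds_nonempty
    (Filter.inter_mem (Filter.inter_mem hev hev') hmem)
  have heq := lempert_eq_of_isCyclic h3 hB hX hBc
  exact lt_asymm (lt_of_lt_of_eq h1 heq) h2

/-- The Lempert function of the spectral ball is upper semicontinuous and bounded below by the lower
semicontinuous function `l(σ(X), σ(Y))`; it is continuous where the two agree. -/
theorem continuousWithinAt_lempert (hA : A ∈ spectralBall n) (hB : B ∈ spectralBall n)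
    (h : lempert (spectralBall n) A B =
      lempert (symmetrizedPolydisk n) (sigma A) (sigma B)) :
    ContinuousWithinAt
      (fun p : Matrix (Fin n) (Fin n) ℂ × Matrix (Fin n) (Fin n) ℂ =>
        lempert (spectralBall n) p.1 p.2) (spectralBall n ×ˢ spectralBall n) (A, B) := by
  refine tendsto_order.2 ⟨fun c hc => ?_, fun c hc =>
    mem_nhdsWithin_of_mem_nhds (eventually_lempert_spectralBall_lt hA hB hc)⟩
  have hσ : Tendsto (fun p : Matrix (Fin n) (Fin n) ℂ × Matrix (Fin n) (Fin n) ℂ =>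
      (sigma p.1, sigma p.2)) (𝓝[spectralBall n ×ˢ spectralBall n] (A, B))
      (𝓝[symmetrizedPolydisk n ×ˢ symmetrizedPolydisk n] (sigma A, sigma B)) :=
    (tendsto_sigma_prod A B).inf (tendsto_principal_principal.2 fun p hp =>
      ⟨mem_image_of_mem _ hp.1, mem_image_of_mem _ hp.2⟩)
  filter_upwards [hσ.eventually (eventually_lt_lempert_symmetrizedPolydisk
    (mem_image_of_mem _ hA) (lt_of_lt_of_eq hc h)), self_mem_nhdsWithin] with p hp hmem
  exact hp.trans_le (lempert_sigma_le hmem.1 hmem.2)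

end LempertSpectral

theorem proposition1p2 (n : ℕ) (A B : Matrix (Fin n) (Fin n) ℂ)
    (hA : A ∈ LempertSpectral.spectralBall n) (hB : B ∈ LempertSpectral.spectralBall n) :
    (ContinuousWithinAt
        (fun p : Matrix (Fin n) (Fin n) ℂ × Matrix (Fin n) (Fin n) ℂ =>
          LempertSpectral.lempert (LempertSpectral.spectralBall n) p.1 p.2)
        (LempertSpectral.spectralBall n ×ˢ LempertSpectral.spectralBall n) (A, B) ↔
      LempertSpectral.lempert (LempertSpectral.spectralBall n) A B =
        LempertSpectral.lempert (LempertSpectral.symmetrizedPolydisk n)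
          (LempertSpectral.sigma A) (LempertSpectral.sigma B)) ∧
    (LempertSpectral.IsCyclic B →
      ContinuousWithinAt
        (fun X : Matrix (Fin n) (Fin n) ℂ =>
          LempertSpectral.lempert (LempertSpectral.spectralBall n) X B)
        (LempertSpectral.spectralBall n) A →
      LempertSpectral.lempert (LempertSpectral.spectralBall n) A B =
        LempertSpectral.lempert (LempertSpectral.symmetrizedPolydisk n)
          (LempertSpectral.sigma A) (LempertSpectral.sigma B)) := by
  exact ⟨⟨LempertSpectral.lempert_eq_of_continuousWithinAt hA hB,
    LempertSpectral.continuousWithinAt_lempert hA hB⟩,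
    LempertSpectral.lempert_eq_of_continuousWithinAt_left hA hB⟩
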